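/- Let $n\ge 1$ and let $P^*=(p_i^*)_{i=1}^n$ be a probability distribution with all $p_i^*>0$. A continuous-time Markov chain on $n$ states is given by rate constants $q_{ij}\ge 0$ ($i\neq j$; $q_{ij}$ is the rate of the transition $j\to i$), and its Kolmogorov equation for $P=(p_i)\in\mathbb{R}^n$ is $$\frac{\mathrm{d}p_i}{\mathrm{d}t}=\sum_{j\neq i}\,(q_{ij}p_j-q_{ji}p_i)\qquad(i=1,\ldots,n).$$ The chain has equilibrium $P^*$ if $\sum_{j\ne i}q_{ij}p_j^*=\bigl(\sum_{j\neq i}q_{ji}\bigr)p_i^*$ for all $i$, and it satisfies detailed balance with equilibrium $P^*$ if $q_{ij}p_j^*=q_{ji}p_i^*$ for all $i\ne j$. For a probability distribution $P^0$ (zero coordinates and coinciding ratios $p^0_i/p^*_i=p^0_j/p^*_j$ are allowed) let $\mathbf{Q}(P^0,P^*)\subset\mathbb{R}^n$ be the set of all velocities $\mathrm{d}P/\mathrm{d}t$ at the point $P^0$ of all Markov chains with equilibrium $P^*$, and let $\Phi(P^0)$ be the set of all values $P(t)$, $t>0$, of solutions with $P(0)=P^0$ of the Kolmogorov equations of all Markov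 chains that satisfy detailed balance with equilibrium $P^*$. Then for every probability distribution $P^0$ there exists a neighbourhood $U$ of $P^0$ in $\mathbb{R}^n$ such that $$\bigl(P^0+\mathbf{Q}(P^0,P^*)\bigr)\cap U=\Phi(P^0)\cap U.$$ -/

import Mathlib

namespace MarkovOrder

/-- Rate constants of a continuous-time Markov chain on `n` states: `q i j` (for `i ≠ j`) is the
rate constant of the transition `j → i`. Diagonal entries play no role. -/
def IsRates {n : ℕ} (q : Fin n → Fin n → ℝ) : Prop :=
  ∀ i j, i ≠ j → 0 ≤ q i j

/-- Right-hand side of the Kolmogorov (master) equation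
`dpᵢ/dt = ∑_{j ≠ i} (q_{ij} pⱼ - q_{ji} pᵢ)`. -/
def velocity {n : ℕ} (q : Fin n → Fin n → ℝ) (P : Fin n → ℝ) : Fin n → ℝ :=
  fun i => ∑ j ∈ Finset.univ.erase i, (q i j * P j - q j i * P i)

/-- Balance condition: `Pst` is an equilibrium of the chain with rate constants `q`. -/
def HasEquilibrium {n : ℕ} (q : Fin n → Fin n → ℝ) (Pst : Fin n → ℝ) : Prop :=
  ∀ i, ∑ j ∈ Finset.univ.erase i, q i j * Pst j
    = (∑ j ∈ Finset.univ.erase i, q j i) * Pst i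

/-- Detailed balance with respect to `Pst`. -/
def DetailedBalance {n : ℕ} (q : Fin n → Fin n → ℝ) (Pst : Fin n → ℝ) : Prop :=
  ∀ i j, q i j * Pst j = q j i * Pst i

/-- `Q(P, P*)`: the set of all velocities `dP/dt` at `P` of all Markov chains
(not necessarily with detailed balance) that have the equilibrium `Pst`. -/
def velocityCone {n : ℕ} (P Pst : Fin n → ℝ) : Set (Fin n → ℝ) :=
  {v | ∃ q : Fin n → Fin n → ℝ, IsRates q ∧ HasEquilibrium q Pst ∧ v = velocity q P}

/-- `P` is a solution, for times `t ≥ 0`, of the Kolmogorov equation with rate constants `q`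
and initial value `P0`. -/
def IsSolution {n : ℕ} (q : Fin n → Fin n → ℝ) (P0 : Fin n → ℝ) (P : ℝ → Fin n → ℝ) : Prop :=
  P 0 = P0 ∧ ∀ t, 0 ≤ t → HasDerivWithinAt P (velocity q (P t)) (Set.Ici 0) t

/-- `Φ(P0)`: the set of all values `P(t)`, `t > 0`, of solutions with `P(0) = P0` of all
Kolmogorov equations satisfying detailed balance with equilibrium `Pst`. -/
def reachable {n : ℕ} (P0 Pst : Fin n → ℝ) : Set (Fin n → ℝ) :=
  {x | ∃ q : Fin n → Fin n → ℝ, IsRates q ∧ DetailedBalance q Pst ∧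
    ∃ P : ℝ → Fin n → ℝ, IsSolution q P0 P ∧ ∃ t, 0 < t ∧ P t = x}

end MarkovOrder

open Topology

namespace MarkovOrder

/-! Put `r i = P0 i / Pst i`. Near `P0`, both sets coincide with `P0` plus the cone of transfers of
mass from `i` to `j` with `r j < r i`; only strict inequalities enter, so ties and zero coordinates
need no separate treatment.

Velocities lie in this cone (`velocityCone_subset_transferCone`): the equilibrium fluxes `q i j *
Pst j` form a circulation, which up to scaling is a doubly stochastic matrix minus the identity.
Birkhoff's theorem reduces the claim to `r ∘ σ - r` for permutations `σ`.

Small elements of the cone are reached by reversible chains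
(`exists_nhds_transferCone_subset_reachable`): the displacement at time one along each pair is its
rate times a time integral that is positive for small rates, and the inverse function theorem solves
for the rates.

Conversely, and without smallness, a time-`t` flow is a stochastic matrix fixing `Pst`; its entries
serve as rates whose velocity at `P0` is `P t - P0` (`IsSolution.sub_mem_velocityCone`). -/

/-- The cone generated by the elementary transfers `e_j - e_i` with `r j < r i`. -/
def transferCone {ι : Type*} [Fintype ι] (r : ι → ℝ) : Set (ι → ℝ) :=
  {v | ∃ w : ι → ι → ℝ, (∀ i j, 0 ≤ w i j) ∧ (∀ i j, r i ≤ r j → w i j = 0) ∧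
    ∀ i, v i = ∑ j, (w j i - w i j)}

/-! ### Permutations, circulations and the transfer cone. -/

section TransferCone

variable {ι : Type*} [Fintype ι] {r : ι → ℝ}

lemma zero_mem_transferCone : (0 : ι → ℝ) ∈ transferCone r :=
  ⟨0, by simp, by simp, by simp⟩

lemma add_mem_transferCone {u v : ι → ℝ} (hu : u ∈ transferCone r) (hv : v ∈ transferCone r) :
    u + v ∈ transferCone r := by
  obtain ⟨a, ha, ha0, hau⟩ := hu
  obtain ⟨b, hb, hb0, hbv⟩ := hv
  refine ⟨a + b, fun i j => add_nonneg (ha i j) (hb i j), fun i j h => ?_, fun i => ?_⟩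
  · simp [ha0 i j h, hb0 i j h]
  · rw [Pi.add_apply, hau, hbv, ← Finset.sum_add_distrib]
    exact Finset.sum_congr rfl fun j _ => by simp only [Pi.add_apply]; ring

lemma smul_mem_transferCone {c : ℝ} (hc : 0 ≤ c) {v : ι → ℝ} (hv : v ∈ transferCone r) :
    c • v ∈ transferCone r := by
  obtain ⟨b, hb, hb0, hbv⟩ := hv
  refine ⟨c • b, fun i j => mul_nonneg hc (hb i j), fun i j h => ?_, fun i => ?_⟩
  · simp [hb0 i j h]
  · rw [Pi.smul_apply, hbv, smul_eq_mul, Finset.mul_sum]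
    exact Finset.sum_congr rfl fun j _ => by simp only [Pi.smul_apply, smul_eq_mul]; ring

lemma sum_mem_transferCone {κ : Type*} (s : Finset κ) (f : κ → ι → ℝ)
    (hf : ∀ k ∈ s, f k ∈ transferCone r) : ∑ k ∈ s, f k ∈ transferCone r :=
  Finset.sum_induction f (· ∈ transferCone r) (fun _ _ => add_mem_transferCone)
    zero_mem_transferCone hf

lemma transfer_mem_transferCone [DecidableEq ι] {i j : ι} (h : r j < r i) :
    Pi.single j 1 - Pi.single i 1 ∈ transferCone r := by
  refine ⟨fun a b => if a = i ∧ b = j then 1 else 0, fun a b => by positivity,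
    fun a b hab => if_neg ?_, fun k => ?_⟩
  · rintro ⟨rfl, rfl⟩
    exact absurd hab (not_le.2 h)
  · simp [Finset.sum_sub_distrib, ite_and, Pi.single_apply]

/-- Permuting the values of `r` changes `r` by a combination of transfers from larger to strictly
smaller values. -/
lemma comp_perm_sub_mem_transferCone [DecidableEq ι] (σ : Equiv.Perm ι) :
    r ∘ σ - r ∈ transferCone r := by
  induction hN : σ.support.card using Nat.strong_induction_on generalizing σ with
  | _ N ih =>
  subst hN
  rcases σ.support.eq_empty_or_nonempty with h0 | hne
  · rw [Equiv.Perm.support_eq_empty_iff] at h0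
    subst h0
    simpa using zero_mem_transferCone
  -- Take `i` maximal for `r` among the moved points and let `k` be sent to `i`. If `r k = r i`,
  -- making `k` fixed does not change `r ∘ σ`. Otherwise making `i` fixed changes `r ∘ σ` by a
  -- transfer from `i` to `k` of amount `r i - r (σ i) ≥ 0`.
  obtain ⟨i, hi, hmax⟩ := σ.support.exists_max_image r hne
  set k := σ⁻¹ i with hk
  have hσk : σ k = i := by simp [hk]
  have hi' : σ i ≠ i := by simpa using hi
  have hki : k ≠ i := fun h => hi' (by rw [← h, hσk, h])
  have hk' : σ k ≠ k := by rw [hσk]; exact hki.symm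
  have hle : r k ≤ r i := hmax k (by simpa using hk')
  rcases hle.eq_or_lt with heq | hlt
  · have := ih _ (Equiv.Perm.card_support_swap_mul hk') (Equiv.swap k (σ k) * σ) rfl
    convert this using 2
    funext x
    simp only [Function.comp_apply, Equiv.Perm.mul_apply, hσk, Equiv.swap_apply_def]
    split_ifs with h1 h2
    · rw [h1, heq]
    · rw [h2, heq]
    · rfl
  · have h1 := ih _ (Equiv.Perm.card_support_swap_mul hi') (Equiv.swap i (σ i) * σ) rfl
    have h2 : (r i - r (σ i)) • (Pi.single k 1 - Pi.single i 1 : ι → ℝ) ∈ transferCone r :=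
      smul_mem_transferCone (sub_nonneg.2 (hmax _ (by simpa using hi')))
        (transfer_mem_transferCone hlt)
    convert add_mem_transferCone h1 h2 using 1
    funext x
    simp only [Pi.add_apply, Pi.sub_apply, Function.comp_apply, Equiv.Perm.mul_apply,
      Pi.smul_apply, smul_eq_mul, Pi.single_apply]
    by_cases hxi : x = i
    · subst hxi
      simp [hki.symm]
    by_cases hxk : x = k
    · subst hxk
      simp [hσk, hki]
    have h3 : σ x ≠ i := fun h => hxk (σ.injective (h.trans hσk.symm))
    have h4 : σ x ≠ σ i := fun h => hxi (σ.injective h)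
    simp [hxi, hxk, Equiv.swap_apply_of_ne_of_ne h3 h4]

/-- A circulation acts on `r` by a combination of transfers from larger to strictly smaller
values. -/
lemma circulation_mem_transferCone [DecidableEq ι] (a : ι → ι → ℝ)
    (ha : ∀ i j, i ≠ j → 0 ≤ a i j) (hbal : ∀ i, ∑ j, a i j = ∑ j, a j i) :
    (fun i => ∑ j, a i j * (r j - r i)) ∈ transferCone r := by
  -- The diagonal has unrestricted sign but is multiplied by `r i - r i`, so it can be dropped.
  set b : ι → ι → ℝ := fun i j => if i = j then 0 else a i j with hb
  have hb0 : ∀ i j, 0 ≤ b i j := fun i j => by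
    simp only [hb]; split_ifs with h
    · exact le_rfl
    · exact ha i j h
  have hbr : ∀ i, ∑ j, b i j = ∑ j, a i j - a i i := fun i => by
    rw [eq_sub_iff_add_eq, ← Finset.sum_erase_add _ _ (Finset.mem_univ i),
      ← Finset.sum_erase_add _ (a i) (Finset.mem_univ i)]
    simp only [hb, if_true, add_zero]
    congr 1
    exact Finset.sum_congr rfl fun j hj => if_neg (Finset.ne_of_mem_erase hj).symm
  have hbc : ∀ i, ∑ j, b j i = ∑ j, a j i - a i i := fun i => by
    rw [eq_sub_iff_add_eq, ← Finset.sum_erase_add _ _ (Finset.mem_univ i),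
      ← Finset.sum_erase_add _ (fun j => a j i) (Finset.mem_univ i)]
    simp only [hb, if_true, add_zero]
    congr 1
    exact Finset.sum_congr rfl fun j hj => if_neg (Finset.ne_of_mem_erase hj)
  -- `N` is positive and bounds every row sum, so the diagonal of `M = 1 + (b - diag (row sums)) /
  -- N` stays nonnegative. Balance gives the column sums, and the circulation acts on `r` as `N • (M
  -- - 1)`.
  set N : ℝ := 1 + ∑ i, ∑ j, b i j with hN
  have hrow : ∀ i, ∑ j, b i j ≤ N := fun i => by
    have := Finset.single_le_sum (f := fun i => ∑ j, b i j)
      (fun i _ => Finset.sum_nonneg fun j _ => hb0 i j) (Finset.mem_univ i)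
    linarith
  have hNpos : 0 < N := by
    have : 0 ≤ ∑ i, ∑ j, b i j :=
      Finset.sum_nonneg fun i _ => Finset.sum_nonneg fun j _ => hb0 i j
    linarith
  let M : Matrix ι ι ℝ := fun i j => b i j / N + if i = j then 1 - (∑ k, b i k) / N else 0
  have hM : M ∈ doublyStochastic ℝ ι := by
    rw [mem_doublyStochastic_iff_sum]
    refine ⟨fun i j => ?_, fun i => ?_, fun j => ?_⟩
    · refine add_nonneg (div_nonneg (hb0 i j) hNpos.le) ?_
      split_ifs
      · rw [sub_nonneg, div_le_one hNpos]
        exact hrow i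
      · exact le_rfl
    · simp only [M]
      rw [Finset.sum_add_distrib, ← Finset.sum_div]
      simp
    · simp only [M]
      rw [Finset.sum_add_distrib, ← Finset.sum_div]
      simp only [Finset.sum_ite_eq', Finset.mem_univ, if_true]
      rw [hbc, hbr, hbal]
      ring
  obtain ⟨w, hw0, hw1, hwM⟩ := exists_eq_sum_perm_of_mem_doublyStochastic hM
  have key : (fun i => ∑ j, a i j * (r j - r i)) = N • ∑ σ, w σ • (r ∘ σ - r) := by
    funext i
    have h1 : ∑ j, M i j * r j = ∑ σ, w σ * r (σ i) := by
      rw [← hwM]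
      simp only [Matrix.sum_apply, Matrix.smul_apply, smul_eq_mul, Finset.sum_mul]
      rw [Finset.sum_comm]
      refine Finset.sum_congr rfl fun σ _ => ?_
      simp [PEquiv.toMatrix_apply]
    have h2 : ∑ σ, w σ * r i = r i := by rw [← Finset.sum_mul, hw1, one_mul]
    have h3 : ∑ j, M i j * r j = (∑ j, b i j * r j) / N + (1 - (∑ k, b i k) / N) * r i := by
      simp only [M, add_mul, Finset.sum_add_distrib, Finset.sum_div]
      congr 1
      · exact Finset.sum_congr rfl fun j _ => by ring
      · simp
    have h4 : ∑ j, a i j * (r j - r i) = ∑ j, b i j * (r j - r i) := by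
      refine Finset.sum_congr rfl fun j _ => ?_
      by_cases h : i = j
      · simp [h]
      · simp [hb, h]
    simp only [Pi.smul_apply, Finset.sum_apply, Pi.sub_apply, Function.comp_apply, smul_eq_mul,
      mul_sub, Finset.sum_sub_distrib] at h4 ⊢
    rw [h4, ← h1, h2, h3, ← Finset.sum_mul]
    field_simp
    ring
  rw [key]
  exact smul_mem_transferCone hNpos.le (sum_mem_transferCone _ _ fun σ _ =>
    smul_mem_transferCone (hw0 σ) (comp_perm_sub_mem_transferCone σ))

end TransferCone

/-! ### Velocities as actions of circulations. -/

section Velocity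

variable {n : ℕ}

lemma velocity_apply (q : Fin n → Fin n → ℝ) (P : Fin n → ℝ) (i : Fin n) :
    velocity q P i = ∑ j, (q i j * P j - q j i * P i) :=
  Finset.sum_erase _ (sub_self _)

lemma hasEquilibrium_iff (q : Fin n → Fin n → ℝ) (P : Fin n → ℝ) :
    HasEquilibrium q P ↔ ∀ i, ∑ j, q i j * P j = (∑ j, q j i) * P i := by
  refine forall_congr' fun i => ?_
  rw [← Finset.sum_erase_add _ _ (Finset.mem_univ i),
    ← Finset.sum_erase_add _ (fun j => q j i) (Finset.mem_univ i), add_mul, add_left_inj]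

lemma DetailedBalance.hasEquilibrium {q : Fin n → Fin n → ℝ} {P : Fin n → ℝ}
    (h : DetailedBalance q P) : HasEquilibrium q P := fun i => by
  rw [Finset.sum_mul]
  exact Finset.sum_congr rfl fun j _ => h i j

/-- Balance lets the outflow coefficient of `i` be replaced by its equilibrium inflow, turning the
velocity into `∑ j, q i j * Pst j * (r j - r i)`. -/
lemma velocityCone_subset_transferCone (P : Fin n → ℝ) {Pst : Fin n → ℝ} (hpos : ∀ i, 0 < Pst i) :
    velocityCone P Pst ⊆ transferCone fun i => P i / Pst i := by
  rintro _ ⟨q, hq, heq, rfl⟩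
  rw [hasEquilibrium_iff] at heq
  have := circulation_mem_transferCone (r := fun i => P i / Pst i) (fun i j => q i j * Pst j)
    (fun i j h => mul_nonneg (hq i j h) (hpos j).le)
    (fun i => by rw [heq, Finset.sum_mul])
  convert this using 1
  funext i
  have h1 : ∑ j, q i j * Pst j * (P i / Pst i) = (∑ j, q j i) * P i := by
    rw [← Finset.sum_mul, heq, mul_assoc, mul_div_cancel₀ _ (hpos i).ne']
  simp only [velocity_apply, mul_sub, Finset.sum_sub_distrib]
  rw [h1, Finset.sum_mul]
  congr 1
  exact Finset.sum_congr rfl fun j _ => by rw [mul_assoc, mul_div_cancel₀ _ (hpos j).ne']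

end Velocity

end MarkovOrder

namespace MarkovOrder

/-! ### Exponentials of bounded operators. -/

section LinearFlow

variable {V : Type*} [NormedAddCommGroup V] [NormedSpace ℝ V] [CompleteSpace V]

lemma hasDerivAt_exp_smul_apply (A : V →L[ℝ] V) (x : V) (t : ℝ) :
    HasDerivAt (fun s : ℝ => NormedSpace.exp (s • A) x) (A (NormedSpace.exp (t • A) x)) t :=
  ((ContinuousLinearMap.apply ℝ V x).hasFDerivAt.comp_hasDerivAt t
    (hasDerivAt_exp_smul_const' A t) :)

lemma exp_apply_hasSum (A : V →L[ℝ] V) (x : V) :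
    HasSum (fun k : ℕ => ((k.factorial : ℝ)⁻¹) • (A ^ k) x) (NormedSpace.exp A x) := by
  simpa using (NormedSpace.exp_series_hasSum_exp' (𝕂 := ℝ) A).mapL
    (ContinuousLinearMap.apply ℝ V x)

/-- The partial sums of the exponential series stay in the closed convex cone `S`. -/
lemma exp_apply_mem_of_mapsTo {A : V →L[ℝ] V} {S : AddSubmonoid V} (hS : IsClosed (S : Set V))
    (hsmul : ∀ c : ℝ, 0 ≤ c → ∀ x ∈ S, c • x ∈ S) (hA : ∀ x ∈ S, A x ∈ S) {x : V} (hx : x ∈ S) :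
    NormedSpace.exp A x ∈ S := by
  have hpow : ∀ k : ℕ, (A ^ k) x ∈ S := fun k => by
    induction k with
    | zero => simpa using hx
    | succ k ih => rw [pow_succ']; exact hA _ ih
  refine hS.mem_of_tendsto (exp_apply_hasSum A x) (Filter.Eventually.of_forall fun s => ?_)
  exact S.sum_mem fun k _ => hsmul _ (by positivity) _ (hpow k)

lemma exp_apply_eq_self {A : V →L[ℝ] V} {x : V} (h : A x = 0) : NormedSpace.exp A x = x := by
  refine (exp_apply_hasSum A x).unique ?_
  convert hasSum_single (f := fun k : ℕ => ((k.factorial : ℝ)⁻¹) • (A ^ k) x) 0 fun k hk => ?_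
  · simp
  · obtain ⟨m, rfl⟩ := Nat.exists_eq_succ_of_ne_zero hk
    simp [pow_succ, h]

lemma map_exp_apply_eq {A : V →L[ℝ] V} {W : Type*} [NormedAddCommGroup W] [NormedSpace ℝ W]
    (l : V →L[ℝ] W) (h : ∀ x, l (A x) = 0) (x : V) : l (NormedSpace.exp A x) = l x := by
  refine ((exp_apply_hasSum A x).mapL l).unique ?_
  convert hasSum_single (f := fun k : ℕ => l (((k.factorial : ℝ)⁻¹) • (A ^ k) x)) 0
    fun k hk => ?_
  · simp
  · obtain ⟨m, rfl⟩ := Nat.exists_eq_succ_of_ne_zero hk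
    simp [pow_succ', h]

end LinearFlow

/-! ### Markov flows are stochastic. -/

section Reachable

variable {n : ℕ}

/-- The velocity as a continuous linear function of the distribution. -/
noncomputable def velocityCLM (q : Fin n → Fin n → ℝ) : (Fin n → ℝ) →L[ℝ] (Fin n → ℝ) :=
  LinearMap.toContinuousLinearMap
    { toFun := velocity q
      map_add' := fun x y => by
        funext i
        simp only [velocity_apply, Pi.add_apply, ← Finset.sum_add_distrib]
        exact Finset.sum_congr rfl fun j _ => by ring
      map_smul' := fun c x => by
        funext i
        simp only [velocity_apply, Pi.smul_apply, smul_eq_mul, RingHom.id_apply, Finset.mul_sum]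
        exact Finset.sum_congr rfl fun j _ => by ring }

@[simp] lemma velocityCLM_apply (q : Fin n → Fin n → ℝ) (P : Fin n → ℝ) :
    velocityCLM q P = velocity q P := rfl

lemma IsSolution.eq_exp {q : Fin n → Fin n → ℝ} {P0 : Fin n → ℝ} {P : ℝ → Fin n → ℝ}
    (h : IsSolution q P0 P) {t : ℝ} (ht : 0 ≤ t) :
    P t = NormedSpace.exp (t • velocityCLM q) P0 := by
  refine ODE_solution_unique (v := fun _ => velocityCLM q) (a := 0) (b := t)
    (g := fun s => NormedSpace.exp (s • velocityCLM q) P0)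
    (fun _ => (velocityCLM q).lipschitz)
    (fun s hs => (h.2 s hs.1).continuousWithinAt.mono fun _ hx => hx.1)
    (fun s hs => (h.2 s hs.1).mono (Set.Ici_subset_Ici.2 hs.1))
    (fun s _ => (hasDerivAt_exp_smul_apply _ _ s).continuousAt.continuousWithinAt)
    (fun s _ => (hasDerivAt_exp_smul_apply _ _ s).hasDerivWithinAt) ?_ ⟨ht, le_rfl⟩
  simp [h.1]

lemma sum_velocity (q : Fin n → Fin n → ℝ) (P : Fin n → ℝ) : ∑ i, velocity q P i = 0 := by
  simp only [velocity_apply, Finset.sum_sub_distrib]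
  rw [sub_eq_zero, Finset.sum_comm]

/-- Adding `c • 1` with `c` at least every total exit rate makes the generator preserve
nonnegativity. The shift commutes with it and contributes only the positive factor `exp (-(t * c))`.
-/
lemma exp_velocityCLM_nonneg {q : Fin n → Fin n → ℝ} (hq : IsRates q) {t : ℝ} (ht : 0 ≤ t)
    {x : Fin n → ℝ} (hx : 0 ≤ x) : 0 ≤ NormedSpace.exp (t • velocityCLM q) x := by
  set c : ℝ := ∑ i, ∑ j, |q j i| with hc
  set A := t • (velocityCLM q + c • (1 : (Fin n → ℝ) →L[ℝ] (Fin n → ℝ))) with hA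
  have hsplit : t • velocityCLM q = A + (-(t * c)) • 1 := by
    rw [hA]
    module
  have hscal : NormedSpace.exp ((-(t * c)) • (1 : (Fin n → ℝ) →L[ℝ] (Fin n → ℝ)))
      = Real.exp (-(t * c)) • 1 := by
    rw [← Algebra.algebraMap_eq_smul_one, ← Algebra.algebraMap_eq_smul_one, Real.exp_eq_exp_ℝ,
      NormedSpace.algebraMap_exp_comm]
  let : NormedAlgebra ℚ ((Fin n → ℝ) →L[ℝ] (Fin n → ℝ)) := NormedAlgebra.restrictScalars ℚ ℝ _
  rw [hsplit, NormedSpace.exp_add_of_commute ((Commute.one_right A).smul_right _), hscal]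
  simp only [mul_smul_comm, mul_one, smul_apply]
  refine smul_nonneg (Real.exp_pos _).le ?_
  refine exp_apply_mem_of_mapsTo (S := AddSubmonoid.nonneg (Fin n → ℝ)) isClosed_Ici
    (fun c hc x hx => ?_) (fun y hy => ?_) hx
  · have hx : 0 ≤ x := hx
    exact smul_nonneg hc hx
  have hy : 0 ≤ y := hy
  suffices h : 0 ≤ (velocityCLM q + c • (1 : (Fin n → ℝ) →L[ℝ] (Fin n → ℝ))) y from
    smul_nonneg ht h
  intro i
  simp only [add_apply, velocityCLM_apply, smul_apply, one_apply_eq_self, Pi.add_apply, Pi.smul_apply, smul_eq_mul, Pi.zero_apply,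
    velocity, Finset.sum_sub_distrib, ← Finset.sum_mul]
  have h1 : 0 ≤ ∑ j ∈ Finset.univ.erase i, q i j * y j := Finset.sum_nonneg fun j hj =>
    mul_nonneg (hq i j (Finset.ne_of_mem_erase hj).symm) (hy j)
  have h2 : ∑ j ∈ Finset.univ.erase i, q j i ≤ c :=
    calc ∑ j ∈ Finset.univ.erase i, q j i ≤ ∑ j ∈ Finset.univ.erase i, |q j i| :=
          Finset.sum_le_sum fun j _ => le_abs_self _
      _ ≤ ∑ j, |q j i| := Finset.sum_le_univ_sum_of_nonneg fun j => abs_nonneg _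
      _ ≤ c := Finset.single_le_sum (f := fun i => ∑ j, |q j i|)
          (fun i _ => Finset.sum_nonneg fun j _ => abs_nonneg _) (Finset.mem_univ i)
  have h3 := mul_le_mul_of_nonneg_right h2 (hy i)
  linarith

/-- A linear map that preserves nonnegativity, total mass and `Pst` moves `P0` by a velocity of a
Markov chain with equilibrium `Pst`. -/
lemma sub_mem_velocityCone_of_stochastic (S : (Fin n → ℝ) →L[ℝ] (Fin n → ℝ))
    (hnonneg : ∀ x, 0 ≤ x → 0 ≤ S x) (hsum : ∀ x, ∑ i, S x i = ∑ i, x i) {Pst : Fin n → ℝ}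
    (hfix : S Pst = Pst) (P0 : Fin n → ℝ) : S P0 - P0 ∈ velocityCone P0 Pst := by
  have hS : ∀ x i, S x i = ∑ j, S (Pi.single j 1) i * x j := fun x i => by
    conv_lhs => rw [pi_eq_sum_univ' x, map_sum]
    simp [mul_comm]
  have hcol : ∀ i, ∑ j, S (Pi.single i 1) j = 1 := fun i => by rw [hsum]; simp
  -- The matrix entries of `S` are the rates: the columns sum to one, so the outflow from `i` is
  -- exactly `P0 i`, and the diagonal terms cancel.
  refine ⟨fun i j => S (Pi.single j 1) i,
    fun i j _ => hnonneg _ (Pi.single_nonneg.2 zero_le_one) i, ?_, ?_⟩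
  · rw [hasEquilibrium_iff]
    intro i
    rw [← hS, hfix, hcol, one_mul]
  · funext i
    rw [velocity_apply, Finset.sum_sub_distrib, ← hS, ← Finset.sum_mul, hcol, one_mul,
      Pi.sub_apply]

lemma IsSolution.sub_mem_velocityCone {q : Fin n → Fin n → ℝ} (hq : IsRates q)
    {Pst : Fin n → ℝ} (heq : HasEquilibrium q Pst) {P0 : Fin n → ℝ} {P : ℝ → Fin n → ℝ}
    (h : IsSolution q P0 P) {t : ℝ} (ht : 0 ≤ t) : P t - P0 ∈ velocityCone P0 Pst := by
  rw [h.eq_exp ht]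
  refine sub_mem_velocityCone_of_stochastic _ (fun x hx => exp_velocityCLM_nonneg hq ht hx)
    (fun x => ?_) (exp_apply_eq_self ?_) P0
  · have := map_exp_apply_eq (A := t • velocityCLM q)
      (∑ i, ContinuousLinearMap.proj (R := ℝ) (φ := fun _ : Fin n => ℝ) i) (fun y => ?_) x
    · simpa using this
    · simp [sum_velocity]
  · rw [smul_apply, velocityCLM_apply]
    convert smul_zero t
    funext i
    rw [velocity_apply, Finset.sum_sub_distrib, (hasEquilibrium_iff q Pst).1 heq i,
      Finset.sum_mul, sub_self, Pi.zero_apply]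

end Reachable

end MarkovOrder


namespace MarkovOrder

/-! ### Local controllability by small rates. -/

section LocalControl

variable {E V : Type*} [Fintype E] [NormedAddCommGroup V] [NormedSpace ℝ V]

/-- The generator on `V × ℝ` of `y' = ∑ e, c e * l e y • γ e + s • x`, `s' = 0`. -/
noncomputable def augmentedGenerator (l : E → V →L[ℝ] ℝ) (γ : E → V) (x : V) (c : E → ℝ) :
    V × ℝ →L[ℝ] V × ℝ :=
  (ContinuousLinearMap.snd ℝ V ℝ).smulRight (x, 0) +
    ∑ e, c e • ((l e).comp (ContinuousLinearMap.fst ℝ V ℝ)).smulRight (γ e, (0 : ℝ))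

lemma augmentedGenerator_apply (l : E → V →L[ℝ] ℝ) (γ : E → V) (x : V) (c : E → ℝ) (z : V × ℝ) :
    augmentedGenerator l γ x c z = (z.2 • x + ∑ e, (c e * l e z.1) • γ e, 0) := by
  ext
  · simp [augmentedGenerator, Prod.fst_sum, smul_smul]
  · simp [augmentedGenerator, Prod.snd_sum]

/-- The integral over `[0, t]` of the flow of `∑ e, c e * l e • γ e` starting from `x`. -/
noncomputable def integratedFlow (l : E → V →L[ℝ] ℝ) (γ : E → V) (x : V) (c : E → ℝ) (t : ℝ) : V :=
  (NormedSpace.exp (t • augmentedGenerator l γ x c) (0, 1)).1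

variable (l : E → V →L[ℝ] ℝ) (γ : E → V) (x : V) (c : E → ℝ)

lemma integratedFlow_zero : integratedFlow l γ x c 0 = 0 := by
  simp [integratedFlow]

variable [CompleteSpace V]

/-- The extra real coordinate is frozen at `1` and so supplies the constant forcing term `x`. -/
lemma hasDerivAt_integratedFlow (t : ℝ) :
    HasDerivAt (integratedFlow l γ x c) (x + ∑ e, (c e * l e (integratedFlow l γ x c t)) • γ e)
      t := by
  have h2 : (NormedSpace.exp (t • augmentedGenerator l γ x c) (0, 1)).2 = 1 :=
    map_exp_apply_eq (ContinuousLinearMap.snd ℝ V ℝ)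
      (fun z => by simp [augmentedGenerator_apply]) (0, 1)
  have := (hasDerivAt_exp_smul_apply (augmentedGenerator l γ x c) (0, 1) t).fst
  rw [augmentedGenerator_apply, h2, one_smul] at this
  exact this

lemma integratedFlow_zero_rates (t : ℝ) : integratedFlow l γ x 0 t = t • x := by
  have h : ∀ s, HasDerivAt (fun s => integratedFlow l γ x 0 s - s • x) 0 s := fun s => by
    simpa using (hasDerivAt_integratedFlow l γ x 0 s).fun_sub ((hasDerivAt_id s).smul_const x)
  have := is_const_of_deriv_eq_zero (fun s => (h s).differentiableAt) (fun s => (h s).deriv) t 0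
  simpa [integratedFlow_zero, sub_eq_zero] using this

/-- The augmented generator is affine in `c` and the operator exponential is analytic. -/
lemma exists_hasStrictFDerivAt_integratedFlow (t : ℝ) :
    ∃ f' : (E → ℝ) →L[ℝ] V, HasStrictFDerivAt (fun c => integratedFlow l γ x c t) f' c := by
  have h1 : ContDiff ℝ 1 fun c => t • augmentedGenerator l γ x c := by
    unfold augmentedGenerator
    fun_prop
  have h2 := (NormedSpace.exp_analytic (𝕂 := ℝ) (t • augmentedGenerator l γ x c)).hasStrictFDerivAt
  have h3 := h2.comp c (h1.contDiffAt.hasStrictFDerivAt one_ne_zero)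
  exact ⟨_, ((ContinuousLinearMap.fst ℝ V ℝ).hasStrictFDerivAt.comp c
    ((ContinuousLinearMap.apply ℝ (V × ℝ) ((0 : V), (1 : ℝ))).hasStrictFDerivAt.comp c h3) :)⟩

/-- The flow of `∑ e, c e * l e • γ e` starting from `x`. -/
lemma hasDerivAt_flow (t : ℝ) :
    HasDerivAt (fun t => x + ∑ e, (c e * l e (integratedFlow l γ x c t)) • γ e)
      (∑ e, (c e * l e (x + ∑ e, (c e * l e (integratedFlow l γ x c t)) • γ e)) • γ e) t := by
  refine (HasDerivAt.fun_sum fun e _ => ?_).const_add x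
  exact (((l e).hasFDerivAt.comp_hasDerivAt t
    (hasDerivAt_integratedFlow l γ x c t)).const_mul (c e)).smul_const (γ e)

/-- Local controllability at time one: every small nonnegative combination of the directions `γ e`
with `0 < l e x` is the displacement of `x` under the flow of `∑ e, c e * l e • γ e` for some
nonnegative rates `c`. -/
lemma exists_nonneg_rates :
    ∃ ε > 0, ∀ v : E → ℝ, (∀ e, 0 ≤ v e) → (∀ e, v e < ε) → (∀ e, l e x ≤ 0 → v e = 0) →
      ∃ c : E → ℝ, (∀ e, 0 ≤ c e) ∧ ∃ P : ℝ → V, P 0 = x ∧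
        (∀ t, HasDerivAt P (∑ e, (c e * l e (P t)) • γ e) t) ∧ P 1 = x + ∑ e, v e • γ e := by
  classical
  set g : E → (E → ℝ) → ℝ := fun e c => if 0 < l e x then l e (integratedFlow l γ x c 1) else 1
    with hg
  have hg0 : ∀ e, 0 < g e 0 := fun e => by
    simp only [hg, integratedFlow_zero_rates, one_smul]
    split_ifs with h
    exacts [h, one_pos]
  have hgd : ∀ e, ∃ g', HasStrictFDerivAt (g e) g' 0 := fun e => by
    by_cases h : 0 < l e x
    · obtain ⟨f', hf'⟩ := exists_hasStrictFDerivAt_integratedFlow l γ x 0 1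
      simp only [hg, if_pos h]
      exact ⟨_, (l e).hasStrictFDerivAt.comp 0 hf'⟩
    · simp only [hg, if_neg h]
      exact ⟨0, hasStrictFDerivAt_const _ _⟩
  choose g' hg' using hgd
  let D : (E → ℝ) →L[ℝ] (E → ℝ) :=
    ContinuousLinearMap.pi fun e => g e 0 • ContinuousLinearMap.proj e
  -- At `c = 0` the term containing the derivative of `g e` vanishes, leaving a diagonal derivative
  -- with positive entries.
  have hΨ : HasStrictFDerivAt (fun c : E → ℝ => fun e => c e * g e c) D 0 := by
    rw [hasStrictFDerivAt_pi']
    intro e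
    refine ((hasStrictFDerivAt_apply e (0 : E → ℝ)).mul (hg' e)).congr_fderiv ?_
    ext1 w
    simp [D]
  have hmap := hΨ.map_nhds_eq_of_surj (LinearMap.range_eq_top.2 fun w =>
    ⟨fun e => w e / g e 0, funext fun e => by simp [D, mul_div_cancel₀ _ (hg0 e).ne']⟩)
  have hpos : ∀ᶠ c in 𝓝 (0 : E → ℝ), ∀ e, 0 < g e c := Filter.eventually_all.2 fun e =>
    (hg' e).continuousAt.eventually (lt_mem_nhds (hg0 e))
  -- Restricting to rates with all `g e c > 0` still covers a neighbourhood of `0`, and there `c e`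
  -- inherits the sign of `v e`.
  have himg := Filter.image_mem_map (m := fun c : E → ℝ => fun e => c e * g e c) hpos
  rw [hmap] at himg
  obtain ⟨ε, hε, hball⟩ := Metric.mem_nhds_iff.1 himg
  refine ⟨ε, hε, fun v hv0 hvε hv => ?_⟩
  have hvmem : v ∈ Metric.ball (fun e => (0 : E → ℝ) e * g e 0) ε := by
    rw [Metric.mem_ball, dist_pi_lt_iff hε]
    intro e
    simpa [abs_of_nonneg (hv0 e)] using hvε e
  obtain ⟨c, hc, hcv⟩ := hball hvmem
  have hcv' : ∀ e, c e * g e c = v e := fun e => congrFun hcv e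
  refine ⟨c, fun e => nonneg_of_mul_nonneg_left ((hcv' e).symm ▸ hv0 e) (hc e), _, ?_,
    hasDerivAt_flow l γ x c, ?_⟩
  · simp [integratedFlow_zero]
  · congr 1
    refine Finset.sum_congr rfl fun e _ => ?_
    by_cases h : 0 < l e x
    · rw [← hcv' e]
      simp only [hg, if_pos h]
    · have h1 := hcv' e
      simp only [hg, if_neg h, mul_one, hv e (not_lt.1 h)] at h1
      rw [h1, zero_mul, hv e (not_lt.1 h)]

end LocalControl

end MarkovOrder

/-! ### Reaching small transfers by reversible chains. -/

namespace MarkovOrder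

/-- The weight of a transfer is controlled by the decrease of `∑ i, r i * v i`. -/
lemma mul_sub_le_of_transfers {ι : Type*} [Fintype ι] {r v : ι → ℝ} {w : ι → ι → ℝ}
    (hw : ∀ i j, 0 ≤ w i j) (hw0 : ∀ i j, r i ≤ r j → w i j = 0)
    (hv : ∀ i, v i = ∑ j, (w j i - w i j)) (i j : ι) :
    w i j * (r i - r j) ≤ -∑ k, r k * v k := by
  have hterm : ∀ a b, 0 ≤ w a b * (r a - r b) := fun a b => by
    rcases le_total (r a) (r b) with h | h
    · simp [hw0 a b h]
    · exact mul_nonneg (hw a b) (sub_nonneg.2 h)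
  have hsum : -∑ k, r k * v k = ∑ a, ∑ b, w a b * (r a - r b) := by
    simp only [hv, Finset.mul_sum, mul_sub, Finset.sum_sub_distrib, neg_sub]
    congr 1
    · simp only [mul_comm]
    · rw [Finset.sum_comm]
      simp only [mul_comm]
  rw [hsum]
  calc w i j * (r i - r j) ≤ ∑ b, w i b * (r i - r b) :=
        Finset.single_le_sum (f := fun b => w i b * (r i - r b)) (fun b _ => hterm i b)
          (Finset.mem_univ j)
    _ ≤ _ := Finset.single_le_sum (f := fun a => ∑ b, w a b * (r a - r b))
          (fun a _ => Finset.sum_nonneg fun b _ => hterm a b) (Finset.mem_univ i)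

variable {n : ℕ}

lemma sum_smul_transfer_apply (w : Fin n × Fin n → ℝ) (i : Fin n) :
    (∑ e, w e • (Pi.single e.2 1 - Pi.single e.1 1 : Fin n → ℝ)) i
      = ∑ j, (w (j, i) - w (i, j)) := by
  simp only [Finset.sum_apply, Pi.smul_apply, Pi.sub_apply, smul_eq_mul, mul_sub,
    Finset.sum_sub_distrib, Fintype.sum_prod_type]
  congr 1
  · simp [Pi.single_apply]
  · rw [Finset.sum_comm]
    simp [Pi.single_apply]

/-- The reversible chain in which the pair `e` carries the flux
`c e * (P e.1 / Pst e.1 - P e.2 / Pst e.2)` from `e.1` to `e.2`. -/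
lemma velocity_reversible {Pst : Fin n → ℝ} (c : Fin n × Fin n → ℝ) (P : Fin n → ℝ) :
    velocity (fun i j => (c (i, j) + c (j, i)) / Pst j) P
      = ∑ e, (c e * (P e.1 / Pst e.1 - P e.2 / Pst e.2)) •
          (Pi.single e.2 1 - Pi.single e.1 1 : Fin n → ℝ) := by
  funext i
  rw [sum_smul_transfer_apply, velocity_apply]
  exact Finset.sum_congr rfl fun j _ => by ring

/-- Small combinations of transfers along strict inequalities are reached by reversible chains. -/
lemma exists_nhds_transferCone_subset_reachable {Pst : Fin n → ℝ} (hpos : ∀ i, 0 < Pst i)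
    (P0 : Fin n → ℝ) :
    ∃ U ∈ nhds P0, ∀ v ∈ transferCone fun i => P0 i / Pst i, P0 + v ∈ U →
      P0 + v ∈ reachable P0 Pst := by
  set r : Fin n → ℝ := fun i => P0 i / Pst i with hr
  let l : Fin n × Fin n → (Fin n → ℝ) →L[ℝ] ℝ := fun e =>
    (Pst e.1)⁻¹ • ContinuousLinearMap.proj e.1 - (Pst e.2)⁻¹ • ContinuousLinearMap.proj e.2
  have hl : ∀ e P, l e P = P e.1 / Pst e.1 - P e.2 / Pst e.2 := fun e P => by
    simp [l, div_eq_inv_mul]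
  obtain ⟨ε, hε, hctrl⟩ := exists_nonneg_rates l
    (fun e => (Pi.single e.2 1 - Pi.single e.1 1 : Fin n → ℝ)) P0
  -- By `mul_sub_le_of_transfers`, on this neighbourhood every transfer representation of the
  -- displacement has all weights below `ε`.
  refine ⟨{x | ∀ i j, r j < r i → -∑ k, r k * (x k - P0 k) < ε * (r i - r j)}, ?_, ?_⟩
  · have hc : Continuous fun x : Fin n → ℝ => -∑ k, r k * (x k - P0 k) := by fun_prop
    refine Filter.eventually_all.2 fun i => Filter.eventually_all.2 fun j => ?_
    by_cases h : r j < r i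
    · have h0 : -∑ k, r k * (P0 k - P0 k) < ε * (r i - r j) := by
        simpa using mul_pos hε (sub_pos.2 h)
      filter_upwards [hc.continuousAt.eventually_lt continuousAt_const h0] with x hx _
      exact hx
    · exact Filter.Eventually.of_forall fun x hx => absurd hx h
  · rintro v ⟨w, hw, hw0, hv⟩ hvU
    have hvU' : ∀ i j, r j < r i → -∑ k, r k * v k < ε * (r i - r j) := by simpa using hvU
    obtain ⟨c, hc, P, hP0, hP, hP1⟩ := hctrl (fun e => w e.1 e.2) (fun e => hw _ _)
      (fun e => by
        rcases le_or_gt (r e.1) (r e.2) with h | h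
        · simpa [hw0 _ _ h] using hε
        · exact lt_of_mul_lt_mul_right
            ((mul_sub_le_of_transfers hw hw0 hv e.1 e.2).trans_lt (hvU' _ _ h))
            (sub_pos.2 h).le)
      (fun e he => hw0 _ _ (by simpa [hl] using he))
    refine ⟨fun i j => (c (i, j) + c (j, i)) / Pst j,
      fun i j _ => div_nonneg (add_nonneg (hc _) (hc _)) (hpos j).le, fun i j => ?_, P,
      ⟨hP0, fun t _ => ?_⟩, 1, one_pos, ?_⟩
    · rw [div_mul_cancel₀ _ (hpos j).ne', div_mul_cancel₀ _ (hpos i).ne', add_comm]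
    · rw [velocity_reversible]
      simpa only [hl] using (hP t).hasDerivWithinAt
    · rw [hP1]
      congr 1
      funext i
      rw [sum_smul_transfer_apply (fun e => w e.1 e.2), hv]

end MarkovOrder

theorem proposition2 (n : ℕ) (Pst P0 : Fin n → ℝ)
    (hPst : Pst ∈ stdSimplex ℝ (Fin n)) (hpos : ∀ i, 0 < Pst i)
    (hP0 : P0 ∈ stdSimplex ℝ (Fin n)) :
    ∃ U ∈ nhds P0,
      ((fun v => P0 + v) '' MarkovOrder.velocityCone P0 Pst) ∩ U
        = MarkovOrder.reachable P0 Pst ∩ U := by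
  obtain ⟨U, hU, hreach⟩ := MarkovOrder.exists_nhds_transferCone_subset_reachable hpos P0
  refine ⟨U, hU, Set.ext fun x => and_congr_left fun hxU => ⟨?_, ?_⟩⟩
  · rintro ⟨v, hv, rfl⟩
    exact hreach v (MarkovOrder.velocityCone_subset_transferCone P0 hpos hv) hxU
  · rintro ⟨q, hq, hdb, P, hP, t, ht, rfl⟩
    exact ⟨P t - P0, hP.sub_mem_velocityCone hq hdb.hasEquilibrium ht.le,
      add_sub_cancel P0 (P t)⟩
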